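/- Let $G$ be a countable group, and let $\mathcal M(G)$ be the space of probability measures on $G$ with the total variation distance $|\nu-\nu'|=\sum_{g}|\nu(g)-\nu'(g)|$. The amenable radical of $G$ is its largest normal amenable subgroup. For $\nu\in\mathcal M(G)$ let $\eta$ be the distribution on $\Omega=G^{\{1,2,\dots\}}$ of the trajectory $(Z_i)_{i\ge1}$, $Z_i=X_1\cdots X_i$, where the $X_i$ are i.i.d. with law $\nu$; $G$ acts on $\Omega$ by $g\cdot(\omega_i)_i=(g\omega_i)_i$. The measure $\nu$ is non-degenerate if its support generates $G$ as a semigroup. The Poisson boundary $\partial(G,\nu)$ is the quotient of $(\Omega,\eta)$ by the $\sigma$-algebra of (time-)shift-invariant sets or, in the description that agrees with it for the measures considered here, by the tail $\sigma$-algebra $\bigcap_n\sigma(\omega_n,\omega_{n+1},\dots)$: that is, a standard Borel space $B$ with a measurable $G$-action, together with a map $\mathrm{bnd}:\Omega\to B$, measurable for the given $\sigma$-algebra, such that $\mathrm{bnd}(g\omega)=g\,\mathrm{bnd}(\omega)$ for every $g\in G$ and $\eta$-almost every $\omega$, and such that every set of the given $\sigma$-algebra is, up to an $\eta$-null set, the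 preimage of a Borel set of $B$; it carries the measure $\mathrm{bnd}_*\eta$. Then for a generic $\nu\in\mathcal M(G)$ (that is, for all $\nu$ in a residual subset of $\mathcal M(G)$), $\nu$ is non-degenerate and the amenable radical of $G$ acts trivially on the Poisson boundary $\partial(G,\nu)$, in either description: every element $g$ of the amenable radical satisfies $g\cdot b=b$ for almost every $b\in\partial(G,\nu)$. -/

import Mathlib

open MeasureTheory Filter Topology
open scoped Pointwise ENNReal

noncomputable section

namespace RandomWalk

universe u v

/-! ### Amenability and the amenable radical -/

open scoped Classical in
/-- A (discrete) group is amenable if for every finite `R` and every `ε > 0` it has a nonempty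
finite `(R, ε)`-invariant subset `F`, i.e. `|R F \ F| < ε |F|` (Følner's condition). -/
def IsAmenable (H : Type u) [Group H] : Prop :=
  ∀ (R : Finset H) (ε : ℝ), 0 < ε →
    ∃ F : Finset H, F.Nonempty ∧ (((R * F) \ F).card : ℝ) < ε * F.card

/-- The amenable radical: the supremum, in the lattice of subgroups, of all normal amenable
subgroups, which is the largest normal amenable subgroup. -/
def amenableRadical (G : Type u) [Group G] : Subgroup G :=
  sSup {N : Subgroup G | N.Normal ∧ IsAmenable N}

/-! ### The space of probability measures with the total variation norm -/

/-- The space of probability measures on the countable set `G`: the nonnegative elements of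
`ℓ¹(G)` of total mass one. As a subtype of `ℓ¹(G)` it carries the distance
`|ν - ν'| = ∑ g, |ν g - ν' g|`. -/
abbrev ProbSpace (G : Type u) : Type u :=
  {p : lp (fun _ : G => ℝ) 1 // (∀ g, 0 ≤ p g) ∧ HasSum (fun g => p g) 1}

variable {G : Type u}

/-- The support generates `G` as a semigroup. -/
def IsNondegenerate [Group G] (ν : ProbSpace G) : Prop :=
  Subsemigroup.closure {g : G | ν.1 g ≠ 0} = ⊤

/-- The measure on `G` with weights `ν g`. -/
def toMeasure [MeasurableSpace G] (ν : ProbSpace G) : Measure G :=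
  Measure.sum fun g => ENNReal.ofReal (ν.1 g) • Measure.dirac g

instance isProbabilityMeasure_toMeasure [MeasurableSpace G] (ν : ProbSpace G) :
    IsProbabilityMeasure (toMeasure ν) := by
  constructor
  rw [toMeasure, Measure.sum_apply _ MeasurableSet.univ]
  simp only [Measure.smul_apply, measure_univ, smul_eq_mul, mul_one]
  rw [← ENNReal.ofReal_tsum_of_nonneg ν.2.1 ν.2.2.summable, ν.2.2.tsum_eq, ENNReal.ofReal_one]

/-! ### Trajectories of the random walk -/

/-- The tail σ-algebra of the path space. -/
def tailAlgebra (G : Type u) [MeasurableSpace G] : MeasurableSpace (ℕ → G) :=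
  ⨅ n : ℕ, ⨆ k : ℕ, ⨆ _ : n ≤ k, MeasurableSpace.comap (fun ω : ℕ → G => ω k) inferInstance

/-- The σ-algebra of the measurable sets of paths that are invariant under the time shift; its
quotient is the space of ergodic components of the shift. -/
def shiftInvariantAlgebra (G : Type u) [MeasurableSpace G] : MeasurableSpace (ℕ → G) :=
  MeasurableSpace.invariants fun (ω : ℕ → G) (n : ℕ) => ω (n + 1)

theorem tailAlgebra_le [MeasurableSpace G] : tailAlgebra G ≤ MeasurableSpace.pi := by
  refine (iInf_le _ 0).trans ?_
  refine iSup_le fun k => iSup_le fun _ => ?_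
  exact (measurable_pi_apply k).comap_le

theorem shiftInvariantAlgebra_le [MeasurableSpace G] : shiftInvariantAlgebra G ≤ MeasurableSpace.pi :=
  MeasurableSpace.invariants_le _

variable [Group G] [MeasurableSpace G] [DiscreteMeasurableSpace G]

/-- The trajectory `(x 0, x 0 * x 1, x 0 * x 1 * x 2, …)` with increments `x`. The coordinate
with index `n` is the position of the walk after `n + 1` steps. -/
def walk (x : ℕ → G) : ℕ → G
  | 0 => x 0
  | n + 1 => walk x n * x (n + 1)

/-- The distribution on the path space `ℕ → G` of the trajectory of the random walk with i.i.d.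
increments of law `ν`. -/
def pathMeasure (ν : ProbSpace G) : Measure (ℕ → G) :=
  (Measure.infinitePi fun _ : ℕ => toMeasure ν).map walk

/-! ### The Poisson boundary -/

/-- `bnd : (ℕ → G) → B` realizes the quotient of the path space of the `ν`-random walk by the
σ-algebra `𝒜`, together with the action of `G`: `B` is a standard Borel space with a measurable
action of `G`, the sets of `𝒜` are, up to null sets, the preimages of the measurable subsets
of `B`, and for each `g` one has `bnd (g • ω) = g • bnd ω` for almost every `ω`. Here `G` acts on
paths by `(g • ω) n = g * ω n`. -/
structure IsBoundary (ν : ProbSpace G) (𝒜 : MeasurableSpace (ℕ → G))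
    (B : Type v) [MeasurableSpace B] [StandardBorelSpace B] [MulAction G B]
    [MeasurableConstSMul G B] (bnd : (ℕ → G) → B) : Prop where
  measurable : Measurable[𝒜] bnd
  exists_ae_eq_preimage : ∀ A : Set (ℕ → G), MeasurableSet[𝒜] A →
    ∃ D : Set B, MeasurableSet D ∧ A =ᵐ[pathMeasure ν] bnd ⁻¹' D
  equivariant : ∀ g : G, ∀ᵐ ω ∂(pathMeasure ν), bnd (g • ω) = g • bnd ω

/-- The Poisson boundary `∂(G, ν)`, described through the tail σ-algebra. It is equipped with the
measure `(pathMeasure ν).map bnd`. -/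
abbrev IsTailBoundary (ν : ProbSpace G) (B : Type v) [MeasurableSpace B] [StandardBorelSpace B]
    [MulAction G B] [MeasurableConstSMul G B] (bnd : (ℕ → G) → B) : Prop :=
  IsBoundary ν (tailAlgebra G) B bnd

/-- The Poisson boundary `∂(G, ν)`, described as the space of ergodic components of the time
shift. It is equipped with the measure `(pathMeasure ν).map bnd`. -/
abbrev IsPoissonBoundary (ν : ProbSpace G) (B : Type v) [MeasurableSpace B]
    [StandardBorelSpace B] [MulAction G B] [MeasurableConstSMul G B]
    (bnd : (ℕ → G) → B) : Prop :=
  IsBoundary ν (shiftInvariantAlgebra G) B bnd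

/-! ### The boundary exists -/

theorem measurable_smul_tail (g : G) :
    Measurable[tailAlgebra G, tailAlgebra G] fun ω : ℕ → G => g • ω := by
  rw [measurable_iff_comap_le]
  refine le_iInf fun n => ?_
  refine (MeasurableSpace.comap_mono (iInf_le _ n)).trans ?_
  simp only [MeasurableSpace.comap_iSup, MeasurableSpace.comap_comp]
  refine iSup_mono fun k => iSup_mono fun _ => ?_
  rintro _ ⟨s, -, rfl⟩
  exact ⟨(fun h => g * h) ⁻¹' s, MeasurableSet.of_discrete, rfl⟩

theorem measurable_smul_path (g : G) : Measurable fun ω : ℕ → G => g • ω := by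
  refine measurable_pi_lambda _ fun n => ?_
  exact (Measurable.of_discrete (f := fun h : G => g * h)).comp (measurable_pi_apply n)

theorem measurable_smul_shiftInvariant (g : G) :
    Measurable[shiftInvariantAlgebra G, shiftInvariantAlgebra G] fun ω : ℕ → G => g • ω := by
  intro A hA
  refine ⟨measurable_smul_path g hA.1, ?_⟩
  ext ω
  have h := Set.ext_iff.1 hA.2 (g • ω)
  exact h

theorem measurable_walk [Countable G] : Measurable (walk : (ℕ → G) → ℕ → G) := by
  refine measurable_pi_lambda _ fun n => ?_
  induction n with
  | zero => exact measurable_pi_apply 0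
  | succ n ih => exact ih.mul (measurable_pi_apply (n + 1))

instance isProbabilityMeasure_pathMeasure [Countable G] (ν : ProbSpace G) :
    IsProbabilityMeasure (pathMeasure ν) :=
  Measure.isProbabilityMeasure_map measurable_walk.aemeasurable

/-- A sub-σ-algebra of a countably generated σ-algebra is, up to null sets, generated by
countably many of its sets. -/
theorem exists_seq_ae_eq {Ω : Type u} {m0 : MeasurableSpace Ω}
    [MeasurableSpace.CountablyGenerated Ω] (μ : Measure Ω) [IsFiniteMeasure μ]
    (m : MeasurableSpace Ω) (hm : m ≤ m0) :
    ∃ a : ℕ → Set Ω, (∀ n, MeasurableSet[m] (a n)) ∧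
      ∀ A, MeasurableSet[m] A → ∃ φ : ℕ → ℕ,
        A =ᵐ[μ] {ω | ∃ N, ∀ i, N ≤ i → ω ∈ a (φ i)} := by
  have : Fact ((1 : ℝ≥0∞) ≤ 1) := ⟨le_rfl⟩
  have : Fact ((1 : ℝ≥0∞) ≠ ⊤) := ⟨ENNReal.one_ne_top⟩
  let ι : {A : Set Ω // MeasurableSet[m] A} → Lp ℝ 1 μ := fun A =>
    indicatorConstLp 1 (hm _ A.2) (measure_ne_top μ _) (1 : ℝ)
  let T : Set (Lp ℝ 1 μ) := Set.range ι
  have : Nonempty T := ⟨⟨_, ⟨⟨∅, MeasurableSet.empty⟩, rfl⟩⟩⟩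
  let d : ℕ → T := TopologicalSpace.denseSeq T
  have hd : DenseRange d := TopologicalSpace.denseRange_denseSeq T
  choose a ha using fun n => (d n).2
  refine ⟨fun n => (a n).1, fun n => (a n).2, fun A hA => ?_⟩
  have hcl : (⟨ι ⟨A, hA⟩, ⟨_, rfl⟩⟩ : T) ∈ closure (Set.range d) := hd _
  obtain ⟨x, hx, hlim⟩ := mem_closure_iff_seq_limit.1 hcl
  choose ψ hψ using hx
  have hlim' : Tendsto (fun i => ι (a (ψ i))) atTop (𝓝 (ι ⟨A, hA⟩)) := by
    have h1 := (continuous_subtype_val.tendsto _).comp hlim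
    refine h1.congr fun i => ?_
    simp only [Function.comp, ← hψ, ha]
  obtain ⟨ns, -, hae⟩ := (tendstoInMeasure_of_tendsto_Lp hlim').exists_seq_tendsto_ae
  refine ⟨fun i => ψ (ns i), ?_⟩
  have hind : ∀ᵐ ω ∂μ, ∀ i, ι (a (ψ (ns i))) ω = (a (ψ (ns i))).1.indicator (fun _ => (1 : ℝ)) ω :=
    ae_all_iff.2 fun i => indicatorConstLp_coeFn
  have hindA : ∀ᵐ ω ∂μ, ι ⟨A, hA⟩ ω = A.indicator (fun _ => (1 : ℝ)) ω := indicatorConstLp_coeFn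
  filter_upwards [hae, hind, hindA] with ω h1 h2 h3
  rw [h3] at h1
  simp only [h2] at h1
  refine propext ?_
  change ω ∈ A ↔ ∃ N, ∀ i, N ≤ i → ω ∈ (a (ψ (ns i))).1
  constructor
  · intro hω
    rw [Set.indicator_of_mem hω] at h1
    obtain ⟨N, hN⟩ := eventually_atTop.1 (h1.eventually (lt_mem_nhds zero_lt_one))
    exact ⟨N, fun i hi => Set.mem_of_indicator_ne_zero (hN i hi).ne'⟩
  · rintro ⟨N, hN⟩
    by_contra hω
    rw [Set.indicator_of_notMem hω] at h1
    obtain ⟨M, hM⟩ := eventually_atTop.1 (h1.eventually (gt_mem_nhds zero_lt_one))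
    have := hM (max M N) (le_max_left _ _)
    rw [Set.indicator_of_mem (hN _ (le_max_right _ _))] at this
    exact lt_irrefl _ this

/-- The space of families of bits indexed by `ℕ × G`, on which `G` acts by translations. -/
def BitSpace (G : Type u) : Type u := ℕ × G → Bool

instance : MeasurableSpace (BitSpace G) := inferInstanceAs (MeasurableSpace (ℕ × G → Bool))

instance [Countable G] : StandardBorelSpace (BitSpace G) :=
  inferInstanceAs (StandardBorelSpace (ℕ × G → Bool))

instance : MulAction G (BitSpace G) where
  smul g b := fun p => b (p.1, g⁻¹ * p.2)
  one_smul b := by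
    funext p
    change b (p.1, 1⁻¹ * p.2) = b p
    simp
  mul_smul g h b := by
    funext p
    change b (p.1, (g * h)⁻¹ * p.2) = b (p.1, h⁻¹ * (g⁻¹ * p.2))
    simp [mul_assoc]

instance : MeasurableConstSMul G (BitSpace G) where
  measurable_const_smul g :=
    measurable_pi_lambda _ fun p => measurable_pi_apply (p.1, g⁻¹ * p.2)

theorem exists_isBoundary [Countable G] (ν : ProbSpace G) (𝒜 : MeasurableSpace (ℕ → G))
    (h𝒜 : 𝒜 ≤ MeasurableSpace.pi) (hsmul : ∀ g : G, Measurable[𝒜, 𝒜] fun ω : ℕ → G => g • ω) :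
    ∃ bnd : (ℕ → G) → BitSpace G, IsBoundary ν 𝒜 (BitSpace G) bnd := by
  classical
  obtain ⟨a, ha, hA⟩ := exists_seq_ae_eq (pathMeasure ν) 𝒜 h𝒜
  refine ⟨fun ω p => decide (p.2⁻¹ • ω ∈ a p.1), ?_, ?_, ?_⟩
  · refine @measurable_pi_lambda _ _ _ 𝒜 _ _ fun p => ?_
    refine @measurable_to_bool _ 𝒜 _ ?_
    have := hsmul p.2⁻¹ (ha p.1)
    have heq : (fun ω : ℕ → G => decide (p.2⁻¹ • ω ∈ a p.1)) ⁻¹' {true} =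
        (fun ω : ℕ → G => p.2⁻¹ • ω) ⁻¹' a p.1 := by
      ext ω
      simp
    rw [heq]
    exact this
  · intro A hAm
    obtain ⟨φ, hφ⟩ := hA A hAm
    refine ⟨⋃ N, ⋂ i, ⋂ (_ : N ≤ i), {b : BitSpace G | b (φ i, 1) = true}, ?_, ?_⟩
    · refine MeasurableSet.iUnion fun N => MeasurableSet.iInter fun i =>
        MeasurableSet.iInter fun _ => ?_
      have h : Measurable fun b : BitSpace G => b (φ i, 1) := measurable_pi_apply (φ i, (1 : G))
      exact h (measurableSet_singleton true)
    · refine hφ.trans (Eq.eventuallyEq ?_)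
      ext ω
      have h1 : ∀ n, decide ((1 : G)⁻¹ • ω ∈ a n) = true ↔ ω ∈ a n := fun n => by
        rw [inv_one, one_smul, decide_eq_true_iff]
      constructor
      · rintro ⟨N, hN⟩
        exact Set.mem_iUnion.2 ⟨N, Set.mem_iInter₂.2 fun i hi => (h1 _).2 (hN i hi)⟩
      · intro h
        obtain ⟨N, hN⟩ := Set.mem_iUnion.1 h
        exact ⟨N, fun i hi => (h1 _).1 (Set.mem_iInter₂.1 hN i hi)⟩
  · intro g
    refine Eventually.of_forall fun ω => ?_
    funext p
    change decide (p.2⁻¹ • g • ω ∈ a p.1) = decide ((g⁻¹ * p.2)⁻¹ • ω ∈ a p.1)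
    rw [smul_smul, mul_inv_rev, inv_inv]

theorem exists_isTailBoundary [Countable G] (ν : ProbSpace G) :
    ∃ bnd : (ℕ → G) → BitSpace G, IsTailBoundary ν (BitSpace G) bnd :=
  exists_isBoundary ν _ tailAlgebra_le measurable_smul_tail

theorem exists_isPoissonBoundary [Countable G] (ν : ProbSpace G) :
    ∃ bnd : (ℕ → G) → BitSpace G, IsPoissonBoundary ν (BitSpace G) bnd :=
  exists_isBoundary ν _ shiftInvariantAlgebra_le measurable_smul_shiftInvariant

end RandomWalk

end

open RandomWalk

namespace RandomWalk

universe u v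

/-! ### Probability vectors -/

section ProbSpace

variable {G : Type u}

/-! For generic `ν` the walk forgets right translations of its starting point by elements `h` of a
normal amenable subgroup `N`: for every `ε` some `n` makes the `n`-step laws from `g * h` and `g`
`ε`-close, uniformly in `g` (`IsAlmostInvariant`). For fixed `h` and `ε` this is an open condition
on `ν`, since `n`-step expectations of functions bounded by one are `n`-Lipschitz in `ν`.

It is also dense (`dense_setOf_isAlmostInvariant`). Replace `ν` by `(1 - t) ν + t κ`, with `κ`
uniform on a Følner set of `N`. Drive the walks from `g * h` and `g` by the same increments: each
step `y` conjugates the discrepancy `h` to `y⁻¹ * h * y`, which stays in `N` by normality and, up to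
small probability, in a finite set fixed before `κ` is chosen. The first `κ`-step almost erases it,
and no `κ`-step occurs in `n` steps only with probability `(1 - t) ^ n`. A countable intersection
over `h` and `ε = 1 / (k + 1)` gives a residual set.

For such `ν`, the probability of hitting a tail set is, for every `n`, the `n`-th Markov iterate of
a function bounded by one, hence invariant under right translation by `N`. Normality converts this
to left translation by `k ∈ N`, also on each cylinder of first increments, so `k • walk x ∈ A` and
`walk x ∈ A` are almost surely equivalent (`ae_smul_walk_mem_iff`). A countable separating family of
Borel sets then shows that `k` fixes almost every boundary point. Elements doing so form a subgroup,
which therefore contains the amenable radical. -/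

/-- The probability measure with the given weights. -/
def ProbSpace.ofWeights (p : G → ℝ) (h0 : ∀ g, 0 ≤ p g) (h1 : HasSum p 1) : ProbSpace G :=
  ⟨⟨p, memℓp_gen (by simpa [abs_of_nonneg (h0 _)] using h1.summable)⟩, h0, h1⟩

theorem ProbSpace.ofWeights_apply (p : G → ℝ) (h0 : ∀ g, 0 ≤ p g) (h1 : HasSum p 1) (g : G) :
    (ProbSpace.ofWeights p h0 h1).1 g = p g := rfl

theorem hasSum_norm_lp_one (p : lp (fun _ : G => ℝ) 1) : HasSum (fun g => |p g|) ‖p‖ := by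
  simpa using lp.hasSum_norm (p := 1) (by simp) p

theorem ProbSpace.norm_eq_one (ν : ProbSpace G) : ‖ν.1‖ = 1 :=
  (hasSum_norm_lp_one ν.1).unique (by simpa only [abs_of_nonneg (ν.2.1 _)] using ν.2.2)

theorem ProbSpace.hasSum_abs_sub (ν ν' : ProbSpace G) :
    HasSum (fun g => |ν.1 g - ν'.1 g|) (dist ν ν') := by
  rw [Subtype.dist_eq, dist_eq_norm]
  exact hasSum_norm_lp_one (ν.1 - ν'.1)

/-- The convex combination `(1 - t) ν + t ν'`. -/
def ProbSpace.mix (t : ℝ) (ht0 : 0 ≤ t) (ht1 : t ≤ 1) (ν ν' : ProbSpace G) : ProbSpace G :=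
  ProbSpace.ofWeights (fun g => (1 - t) * ν.1 g + t * ν'.1 g)
    (fun g => add_nonneg (mul_nonneg (sub_nonneg.2 ht1) (ν.2.1 g)) (mul_nonneg ht0 (ν'.2.1 g)))
    (by simpa using (ν.2.2.mul_left (1 - t)).add (ν'.2.2.mul_left t))

theorem ProbSpace.mix_apply {t : ℝ} (ht0 : 0 ≤ t) (ht1 : t ≤ 1) (ν ν' : ProbSpace G) (g : G) :
    (ProbSpace.mix t ht0 ht1 ν ν').1 g = (1 - t) * ν.1 g + t * ν'.1 g := rfl

theorem ProbSpace.dist_mix_le {t : ℝ} (ht0 : 0 ≤ t) (ht1 : t ≤ 1) (ν ν' : ProbSpace G) :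
    dist (ProbSpace.mix t ht0 ht1 ν ν') ν ≤ 2 * t := by
  have h : (ProbSpace.mix t ht0 ht1 ν ν').1 - ν.1 = t • (ν'.1 - ν.1) := by
    ext g
    simp only [lp.coeFn_sub, lp.coeFn_smul, Pi.sub_apply, Pi.smul_apply, smul_eq_mul,
      ProbSpace.mix_apply]
    ring
  rw [Subtype.dist_eq, dist_eq_norm, h, norm_smul, Real.norm_of_nonneg ht0]
  have := norm_sub_le ν'.1 ν.1
  rw [ν.norm_eq_one, ν'.norm_eq_one] at this
  nlinarith

theorem hasSum_indicator_finset (S : Finset G) (f : G → ℝ) :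
    HasSum ((S : Set G).indicator f) (∑ g ∈ S, f g) := by
  have h : HasSum ((S : Set G).indicator f) (∑ g ∈ S, (S : Set G).indicator f g) :=
    hasSum_sum_of_ne_finset_zero fun g hg => Set.indicator_of_notMem (by simpa using hg) _
  rwa [Finset.sum_congr rfl fun g hg => Set.indicator_of_mem (by simpa using hg) _] at h

/-- The uniform distribution on a nonempty finite set. -/
noncomputable def ProbSpace.uniform (F : Finset G) (hF : F.Nonempty) : ProbSpace G :=
  ProbSpace.ofWeights ((F : Set G).indicator fun _ => (F.card : ℝ)⁻¹)
    (fun g => Set.indicator_nonneg (fun _ _ => by positivity) g) (by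
      have h3 : (F.card : ℝ) ≠ 0 := by simpa using hF.ne_empty
      simpa [h3] using hasSum_indicator_finset F fun _ => (F.card : ℝ)⁻¹)

theorem ProbSpace.uniform_apply_of_mem {F : Finset G} (hF : F.Nonempty) {g : G} (hg : g ∈ F) :
    (ProbSpace.uniform F hF).1 g = (F.card : ℝ)⁻¹ := by
  rw [ProbSpace.uniform, ProbSpace.ofWeights_apply, Set.indicator_of_mem (by simpa using hg)]

theorem ProbSpace.uniform_apply_of_notMem {F : Finset G} (hF : F.Nonempty) {g : G} (hg : g ∉ F) :
    (ProbSpace.uniform F hF).1 g = 0 := by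
  rw [ProbSpace.uniform, ProbSpace.ofWeights_apply, Set.indicator_of_notMem (by simpa using hg)]

theorem ProbSpace.summable_mul (ν : ProbSpace G) {f : G → ℝ} {C : ℝ} (hf : ∀ g, |f g| ≤ C) :
    Summable fun g => ν.1 g * f g := by
  refine Summable.of_norm_bounded (ν.2.2.summable.mul_right C) fun g => ?_
  rw [Real.norm_eq_abs, abs_mul, abs_of_nonneg (ν.2.1 g)]
  exact mul_le_mul_of_nonneg_left (hf g) (ν.2.1 g)

theorem ProbSpace.abs_tsum_mul_le (ν : ProbSpace G) {f : G → ℝ} {C : ℝ} (hf : ∀ g, |f g| ≤ C) :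
    |∑' g, ν.1 g * f g| ≤ C := by
  have h : ∀ g, ‖ν.1 g * f g‖ ≤ ν.1 g * C := fun g => by
    rw [Real.norm_eq_abs, abs_mul, abs_of_nonneg (ν.2.1 g)]
    exact mul_le_mul_of_nonneg_left (hf g) (ν.2.1 g)
  simpa using tsum_of_norm_bounded (ν.2.2.mul_right C) h

theorem ProbSpace.abs_tsum_mul_sub_le (ν ν' : ProbSpace G) {f : G → ℝ} (hf : ∀ g, |f g| ≤ 1) :
    |∑' g, ν.1 g * f g - ∑' g, ν'.1 g * f g| ≤ dist ν ν' := by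
  rw [← (ν.summable_mul hf).tsum_sub (ν'.summable_mul hf), ← Real.norm_eq_abs]
  refine tsum_of_norm_bounded (ProbSpace.hasSum_abs_sub ν ν') fun g => ?_
  rw [← sub_mul, Real.norm_eq_abs, abs_mul]
  exact mul_le_of_le_one_right (abs_nonneg _) (hf g)

/-- If `f` is at most `C` on a set carrying all but `η` of the mass, and at most `D` elsewhere, then
its mean is at most `C + η D`. -/
theorem ProbSpace.abs_tsum_mul_le_of_finset (ν : ProbSpace G) {f : G → ℝ} {C D η : ℝ}
    (S : Finset G) (hS : 1 - η ≤ ∑ g ∈ S, ν.1 g) (hC0 : 0 ≤ C) (hD0 : 0 ≤ D)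
    (hC : ∀ g ∈ S, |f g| ≤ C) (hD : ∀ g, |f g| ≤ D) :
    |∑' g, ν.1 g * f g| ≤ C + η * D := by
  have hind := hasSum_indicator_finset S fun g => ν.1 g
  have hsum : HasSum (fun g => ν.1 g * C + (ν.1 g - (S : Set G).indicator (fun g => ν.1 g) g) * D)
      (1 * C + (1 - ∑ g ∈ S, ν.1 g) * D) :=
    (ν.2.2.mul_right C).add ((ν.2.2.sub hind).mul_right D)
  have h := tsum_of_norm_bounded (f := fun g => ν.1 g * f g) hsum fun g => by
    rw [Real.norm_eq_abs, abs_mul, abs_of_nonneg (ν.2.1 g)]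
    by_cases hg : g ∈ S
    · rw [Set.indicator_of_mem (by simpa using hg)]
      simpa using mul_le_mul_of_nonneg_left (hC g hg) (ν.2.1 g)
    · rw [Set.indicator_of_notMem (by simpa using hg), sub_zero]
      have h1 := mul_le_mul_of_nonneg_left (hD g) (ν.2.1 g)
      have h2 := mul_nonneg (ν.2.1 g) hC0
      linarith
  rw [Real.norm_eq_abs] at h
  nlinarith

end ProbSpace

/-! ### The Markov operator -/

section Markov

variable {G : Type u} [Group G]

/-- The Markov operator of the `ν`-random walk. -/
noncomputable def markov (ν : ProbSpace G) (f : G → ℝ) (g : G) : ℝ := ∑' y, ν.1 y * f (g * y)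

theorem abs_markov_le (ν : ProbSpace G) {f : G → ℝ} {C : ℝ} (hf : ∀ g, |f g| ≤ C) (g : G) :
    |markov ν f g| ≤ C :=
  ν.abs_tsum_mul_le fun y => hf (g * y)

theorem abs_iterate_markov_le (ν : ProbSpace G) {f : G → ℝ} {C : ℝ} (hf : ∀ g, |f g| ≤ C) (n : ℕ)
    (g : G) : |(markov ν)^[n] f g| ≤ C := by
  induction n generalizing g with
  | zero => exact hf g
  | succ n ih => rw [Function.iterate_succ_apply']; exact abs_markov_le ν ih g

theorem markov_sub_markov (ν : ProbSpace G) {f f' : G → ℝ} {C : ℝ} (hf : ∀ g, |f g| ≤ C)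
    (hf' : ∀ g, |f' g| ≤ C) (g g' : G) :
    markov ν f g - markov ν f' g' = ∑' y, ν.1 y * (f (g * y) - f' (g' * y)) := by
  unfold markov
  rw [← (ν.summable_mul fun y => hf (g * y)).tsum_sub (ν.summable_mul fun y => hf' (g' * y))]
  simp only [mul_sub]

/-- Replacing `ν` by `ν'` one step at a time costs at most `dist ν ν'` per step, since both
operators contract the sup norm. -/
theorem abs_iterate_markov_sub_le (ν ν' : ProbSpace G) {f : G → ℝ} (hf : ∀ g, |f g| ≤ 1) (n : ℕ)
    (g : G) : |(markov ν)^[n] f g - (markov ν')^[n] f g| ≤ n * dist ν ν' := by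
  induction n generalizing g with
  | zero => simp
  | succ n ih =>
    simp only [Function.iterate_succ_apply']
    have h1 : |markov ν ((markov ν)^[n] f) g - markov ν ((markov ν')^[n] f) g|
        ≤ n * dist ν ν' := by
      rw [markov_sub_markov ν (abs_iterate_markov_le ν hf n) (abs_iterate_markov_le ν' hf n)]
      exact ν.abs_tsum_mul_le fun y => ih (g * y)
    have h2 : |markov ν ((markov ν')^[n] f) g - markov ν' ((markov ν')^[n] f) g| ≤ dist ν ν' :=
      ν.abs_tsum_mul_sub_le ν' fun y => abs_iterate_markov_le ν' hf n (g * y)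
    have h3 := abs_sub_le (markov ν ((markov ν)^[n] f) g) (markov ν ((markov ν')^[n] f) g)
      (markov ν' ((markov ν')^[n] f) g)
    push_cast
    linarith

/-! ### Asymptotic invariance of the `n`-step laws -/

/-- After `n` steps, the walks started at `g * h` and at `g` have laws at distance at most `ε`. -/
def IsAlmostInvariant (ν : ProbSpace G) (n : ℕ) (h : G) (ε : ℝ) : Prop :=
  ∀ f : G → ℝ, (∀ g, |f g| ≤ 1) → ∀ g, |(markov ν)^[n] f (g * h) - (markov ν)^[n] f g| ≤ ε

theorem IsAlmostInvariant.of_dist {ν ν' : ProbSpace G} {n : ℕ} {h : G} {ε : ℝ}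
    (H : IsAlmostInvariant ν n h ε) : IsAlmostInvariant ν' n h (ε + 2 * n * dist ν' ν) := by
  intro f hf g
  have h1 := abs_le.1 (abs_iterate_markov_sub_le ν' ν hf n (g * h))
  have h2 := abs_le.1 (abs_iterate_markov_sub_le ν' ν hf n g)
  have h3 := abs_le.1 (H f hf g)
  exact abs_le.2 ⟨by linarith, by linarith⟩

/-- The strict inequality `ε' < ε` leaves room for the error `2 * n * dist ν' ν` of a perturbation,
with `n` kept fixed. -/
theorem isOpen_setOf_isAlmostInvariant (h : G) (ε : ℝ) :
    IsOpen {ν : ProbSpace G | ∃ n, ∃ ε' < ε, IsAlmostInvariant ν n h ε'} := by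
  refine Metric.isOpen_iff.2 ?_
  rintro ν ⟨n, ε', hε', H⟩
  refine ⟨(ε - ε') / (2 * n + 1), div_pos (sub_pos.2 hε') (by positivity), fun ν' hν' => ?_⟩
  refine ⟨n, _, ?_, H.of_dist (ν' := ν')⟩
  have h1 := (lt_div_iff₀ (by positivity)).1 (Metric.mem_ball.1 hν')
  have h2 : 0 ≤ dist ν' ν := dist_nonneg
  linarith

/-- A step of law `(1 - t) ν + t κ`, with `κ` almost invariant under the conjugates of `h`. -/
theorem isAlmostInvariant_mix {t : ℝ} (ht0 : 0 ≤ t) (ht1 : t ≤ 1) (ν κ : ProbSpace G)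
    (S : Finset G) {η : ℝ} (hη : 0 ≤ η) (hS : 1 - η ≤ ∑ g ∈ S, ν.1 g) {ε : ℝ} (hε : 0 ≤ ε)
    (R : ℕ → Set G) (hR : ∀ n, ∀ h ∈ R (n + 1), ∀ y ∈ S, y⁻¹ * h * y ∈ R n)
    (hκ : ∀ n, ∀ h ∈ R (n + 1), ∀ f : G → ℝ, (∀ g, |f g| ≤ 1) →
      |∑' y, κ.1 y * (f (h * y) - f y)| ≤ ε) (n : ℕ) :
    ∀ h ∈ R n, IsAlmostInvariant (ProbSpace.mix t ht0 ht1 ν κ) n h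
      (2 * (1 - t) ^ n + ε + 2 * n * η) := by
  induction n with
  | zero =>
    intro h _ f hf g
    have := abs_sub (f (g * h)) (f g)
    have h1 := hf (g * h)
    have h2 := hf g
    simp only [Function.iterate_zero, id]
    norm_num
    linarith
  | succ n ih =>
    intro h hh f hf g
    set μ := ProbSpace.mix t ht0 ht1 ν κ with hμ
    set q := (markov μ)^[n] f with hq
    have hq1 : ∀ g, |q g| ≤ 1 := abs_iterate_markov_le μ hf n
    rw [Function.iterate_succ_apply', ← hq, markov_sub_markov μ hq1 hq1]
    have hd : ∀ y, |q (g * h * y) - q (g * y)| ≤ 2 := fun y => by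
      have := abs_sub (q (g * h * y)) (q (g * y))
      linarith [hq1 (g * h * y), hq1 (g * y)]
    have hsplit : ∑' y, μ.1 y * (q (g * h * y) - q (g * y)) =
        (1 - t) * ∑' y, ν.1 y * (q (g * h * y) - q (g * y)) +
          t * ∑' y, κ.1 y * (q (g * h * y) - q (g * y)) := by
      rw [← tsum_mul_left, ← tsum_mul_left,
        ← ((ν.summable_mul hd).mul_left _).tsum_add ((κ.summable_mul hd).mul_left _)]
      refine tsum_congr fun y => ?_
      rw [hμ, ProbSpace.mix_apply]
      ring
    have ht : 0 ≤ 1 - t := sub_nonneg.2 ht1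
    -- A common step `y` turns the pair `g * h`, `g` into `g * y * (y⁻¹ * h * y)`, `g * y`, to which
    -- induction applies if `y ∈ S`. The remaining mass, at most `η`, is met with the trivial bound
    -- `2`.
    have h1 : |∑' y, ν.1 y * (q (g * h * y) - q (g * y))| ≤
        (2 * (1 - t) ^ n + ε + 2 * n * η) + η * 2 := by
      refine ν.abs_tsum_mul_le_of_finset S hS (by positivity) zero_le_two (fun y hy => ?_) hd
      have := ih _ (hR n h hh y hy) f hf (g * y)
      rwa [show g * y * (y⁻¹ * h * y) = g * h * y by group] at this
    have h2 : |∑' y, κ.1 y * (q (g * h * y) - q (g * y))| ≤ ε := by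
      have := hκ n h hh (fun x => q (g * x)) fun x => hq1 _
      simpa only [mul_assoc] using this
    rw [hsplit]
    refine (abs_add_le _ _).trans ?_
    rw [abs_mul, abs_mul, abs_of_nonneg ht, abs_of_nonneg ht0]
    have h3 := mul_le_mul_of_nonneg_left h1 ht
    have h4 := mul_le_mul_of_nonneg_left h2 ht0
    -- The recursion `(1 - t) * (a n + 2 * η) + t * ε` falls below the claimed `a (n + 1)` by
    -- exactly `2 * t * (n + 1) * η`, which this discards.
    have h5 : 0 ≤ t * ((n + 1) * η) := by positivity
    push_cast
    rw [pow_succ]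
    nlinarith

/-- The sum is the normalized difference of the sums of `f` over `h • F` and `F`, so only the
symmetric difference contributes. Its two halves have equal cardinality, whence the factor `2`. -/
theorem abs_tsum_uniform_le (F : Finset G) (hF : F.Nonempty) (h : G) [DecidableEq G] {ε : ℝ}
    (hε : ((h • F \ F).card : ℝ) ≤ ε * F.card) (f : G → ℝ) (hf : ∀ g, |f g| ≤ 1) :
    |∑' y, (ProbSpace.uniform F hF).1 y * (f (h * y) - f y)| ≤ 2 * ε := by
  have hcard : (0 : ℝ) < F.card := by exact_mod_cast hF.card_pos
  have h0 : ∀ y ∉ F, (ProbSpace.uniform F hF).1 y * (f (h * y) - f y) = 0 := fun y hy => by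
    rw [ProbSpace.uniform_apply_of_notMem hF hy, zero_mul]
  rw [tsum_eq_sum h0]
  have h1 : ∑ y ∈ F, (ProbSpace.uniform F hF).1 y * (f (h * y) - f y) =
      (F.card : ℝ)⁻¹ * (∑ y ∈ h • F, f y - ∑ y ∈ F, f y) := by
    have : ∑ y ∈ h • F, f y = ∑ y ∈ F, f (h * y) :=
      Finset.sum_image (f := f) (MulAction.injective h).injOn
    rw [this, ← Finset.sum_sub_distrib, Finset.mul_sum]
    exact Finset.sum_congr rfl fun y hy => by rw [ProbSpace.uniform_apply_of_mem hF hy]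
  have hb : ∀ s : Finset G, |∑ y ∈ s, f y| ≤ s.card := fun s => by
    simpa using (Finset.abs_sum_le_sum_abs f s).trans (Finset.sum_le_sum fun y _ => hf y)
  have h2 : ∑ y ∈ h • F, f y - ∑ y ∈ F, f y = ∑ y ∈ h • F \ F, f y - ∑ y ∈ F \ h • F, f y := by
    exact (Finset.sum_sdiff_sub_sum_sdiff (f := f)).symm
  have h3 : (F \ h • F).card = (h • F \ F).card :=
    Finset.card_sdiff_comm (Finset.card_smul_finset h F).symm
  have h4 := hb (h • F \ F)
  have h5 := hb (F \ h • F)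
  have h6 := abs_sub (∑ y ∈ h • F \ F, f y) (∑ y ∈ F \ h • F, f y)
  rw [h1, h2, abs_mul, abs_of_pos (inv_pos.2 hcard), inv_mul_le_iff₀ hcard]
  rw [h3] at h5
  linarith

/-! ### Genericity -/

theorem dense_setOf_isAlmostInvariant {N : Subgroup G} [N.Normal] (hN : IsAmenable N) {h : G}
    (hh : h ∈ N) {ε : ℝ} (hε : 0 < ε) :
    Dense {ν : ProbSpace G | ∃ n, ∃ ε' < ε, IsAlmostInvariant ν n h ε'} := by
  classical
  refine Metric.dense_iff.2 fun ν r hr => ?_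
  -- The order of choices matters: `t` from the radius, `n` from `t`, `η` from `n`, the finite set
  -- `S` from `η`, the conjugates `T n` of `h` from `S`, and last the Følner set. The three error
  -- terms are then at most `ε / 4` each.
  obtain ⟨t, ht0, htr⟩ := exists_between (lt_min (half_pos hr) one_pos)
  obtain ⟨htr, ht1⟩ := lt_min_iff.1 htr
  obtain ⟨n, hn⟩ := exists_pow_lt_of_lt_one (show 0 < ε / 8 by positivity)
    (show 1 - t < 1 by linarith)
  set η : ℝ := ε / (8 * (n + 1)) with hη
  have hη0 : 0 < η := by positivity
  obtain ⟨S, hS⟩ : ∃ S : Finset G, 1 - η < ∑ g ∈ S, ν.1 g :=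
    (ν.2.2.eventually (lt_mem_nhds (show 1 - η < 1 by linarith))).exists
  -- `T k` collects the conjugates of `h` by products of at most `k` elements of `S`.
  let T : ℕ → Finset G := fun k => Nat.rec {h} (fun _ U => U ∪ S.biUnion fun y =>
    U.image fun x => y⁻¹ * x * y) k
  have hTsucc : ∀ k, T (k + 1) = T k ∪ S.biUnion fun y => (T k).image fun x => y⁻¹ * x * y :=
    fun k => rfl
  have hTN : ∀ k, ∀ x ∈ T k, x ∈ N := by
    intro k
    induction k with
    | zero => intro x hx; obtain rfl : x = h := Finset.mem_singleton.1 hx; exact hh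
    | succ k ih =>
      intro x hx
      rw [hTsucc, Finset.mem_union, Finset.mem_biUnion] at hx
      obtain hx | ⟨y, -, hx⟩ := hx
      · exact ih x hx
      · obtain ⟨z, hz, rfl⟩ := Finset.mem_image.1 hx
        simpa using ‹N.Normal›.conj_mem z (ih z hz) y⁻¹
  have hTmono : Monotone T := monotone_nat_of_le_succ fun k => by
    rw [hTsucc]; exact Finset.subset_union_left
  obtain ⟨F, hF, hFε⟩ := hN ((T n).subtype (· ∈ N)) (ε / 8) (by positivity)
  let F' : Finset G := F.map ⟨Subtype.val, Subtype.val_injective⟩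
  have hF' : F'.Nonempty := hF.map
  have hcard : F'.card = F.card := Finset.card_map _
  have hinv : ∀ x ∈ T n, ((x • F' \ F').card : ℝ) ≤ ε / 8 * F'.card := by
    intro x hx
    rw [hcard]
    refine le_trans ?_ hFε.le
    have hsub : x • F' \ F' ⊆ ((((T n).subtype (· ∈ N)) * F) \ F).map
        ⟨Subtype.val, Subtype.val_injective⟩ := by
      intro y hy
      obtain ⟨hy1, hy2⟩ := Finset.mem_sdiff.1 hy
      obtain ⟨z, hz, rfl⟩ := Finset.mem_smul_finset.1 hy1
      obtain ⟨w, hw, rfl⟩ := Finset.mem_map.1 hz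
      refine Finset.mem_map.2 ⟨⟨x, hTN n x hx⟩ * w, Finset.mem_sdiff.2
        ⟨Finset.mul_mem_mul (by simpa using hx) hw, fun hmem => hy2 ?_⟩, rfl⟩
      exact Finset.mem_map.2 ⟨_, hmem, rfl⟩
    have := Finset.card_le_card hsub
    rw [Finset.card_map] at this
    convert! (Nat.cast_le (α := ℝ)).2 this
  -- The index `k` counts the steps still to come, so `h` has been conjugated up to `n - k` times.
  -- The condition `k ≤ n` keeps the truncated subtraction honest.
  refine ⟨ProbSpace.mix t ht0.le ht1.le ν (ProbSpace.uniform F' hF'), ?_, n, _, ?_,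
    isAlmostInvariant_mix ht0.le ht1.le ν (ProbSpace.uniform F' hF') S hη0.le hS.le
      (show (0 : ℝ) ≤ 2 * (ε / 8) by positivity) (fun k => {x | x ∈ T (n - k) ∧ k ≤ n}) ?_ ?_ n h ?_⟩
  · refine Metric.mem_ball.2 ((ProbSpace.dist_mix_le _ _ _ _).trans_lt ?_)
    linarith
  · have h1 : 2 * n * η ≤ ε / 4 := by
      rw [hη, mul_div_assoc', div_le_iff₀ (by positivity)]
      nlinarith
    linarith
  · rintro k x ⟨hx, hk⟩ y hy
    refine ⟨?_, by omega⟩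
    rw [show n - k = (n - (k + 1)) + 1 by omega, hTsucc]
    exact Finset.mem_union_right _ (Finset.mem_biUnion.2 ⟨y, hy, Finset.mem_image_of_mem _ hx⟩)
  · rintro k x ⟨hx, hk⟩ f hf
    exact abs_tsum_uniform_le F' hF' x (hinv x (hTmono (Nat.sub_le _ _) hx)) f hf
  · simp [T]

/-- Generically every element of `G` has positive mass, which is more than enough. -/
theorem eventually_residual_isNondegenerate [Countable G] :
    ∀ᶠ ν in residual (ProbSpace G), IsNondegenerate ν := by
  have h : ∀ g : G, ∀ᶠ ν in residual (ProbSpace G), ν.1 g ≠ 0 := by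
    intro g
    refine residual_of_dense_open ?_ ?_
    · refine isOpen_ne_fun ?_ continuous_const
      have h1 : Continuous fun p : lp (fun _ : G => ℝ) 1 => p g :=
        (continuous_apply g).comp (lp.uniformContinuous_coe (p := 1)).continuous
      exact h1.comp continuous_subtype_val
    · refine Metric.dense_iff.2 fun ν r hr => ?_
      obtain ⟨t, ht0, htr⟩ := exists_between (lt_min (half_pos hr) one_pos)
      obtain ⟨htr, ht1⟩ := lt_min_iff.1 htr
      have hg := Finset.singleton_nonempty g
      refine ⟨ProbSpace.mix t ht0.le ht1.le ν (ProbSpace.uniform {g} hg), ?_, ?_⟩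
      · refine Metric.mem_ball.2 ((ProbSpace.dist_mix_le _ _ _ _).trans_lt ?_)
        linarith
      · have h1 := mul_nonneg (sub_nonneg.2 ht1.le) (ν.2.1 g)
        have h2 := ProbSpace.uniform_apply_of_mem hg (Finset.mem_singleton_self g)
        refine ne_of_gt ?_
        rw [ProbSpace.mix_apply, h2]
        simp only [Finset.card_singleton, Nat.cast_one, inv_one, mul_one]
        linarith
  filter_upwards [eventually_countable_forall.2 h] with ν hν
  exact eq_top_iff.2 fun g _ => Subsemigroup.subset_closure (hν g)

theorem eventually_residual_isAlmostInvariant [Countable G] :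
    ∀ᶠ ν in residual (ProbSpace G), ∀ N : Subgroup G, N.Normal → IsAmenable N → ∀ h ∈ N,
      ∀ ε > 0, ∃ n, IsAlmostInvariant ν n h ε := by
  -- The intersection runs over `h` and `k` only, with the existence of `N` inside the statement:
  -- there may be uncountably many subgroups `N`, but the open dense set does not depend on the
  -- choice.
  have H : ∀ h : G, ∀ k : ℕ, ∀ᶠ ν in residual (ProbSpace G),
      (∃ N : Subgroup G, N.Normal ∧ IsAmenable N ∧ h ∈ N) →
        ∃ n, ∃ ε' < 1 / ((k : ℝ) + 1), IsAlmostInvariant ν n h ε' := by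
    intro h k
    by_cases hN : ∃ N : Subgroup G, N.Normal ∧ IsAmenable N ∧ h ∈ N
    · obtain ⟨N, hN1, hN2, hh⟩ := hN
      filter_upwards [residual_of_dense_open (isOpen_setOf_isAlmostInvariant h (1 / ((k : ℝ) + 1)))
        (dense_setOf_isAlmostInvariant hN2 hh Nat.one_div_pos_of_nat)] with ν hν _
      exact hν
    · exact Eventually.of_forall fun ν h' => absurd h' hN
  filter_upwards [eventually_countable_forall.2 fun h => eventually_countable_forall.2 (H h)]
    with ν hν N hN1 hN2 h hh ε hε
  obtain ⟨k, hk⟩ := exists_nat_one_div_lt hε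
  obtain ⟨n, ε', hε', hn⟩ := hν h k ⟨N, hN1, hN2, hh⟩
  exact ⟨n, fun f hf g => (hn f hf g).trans (hε'.trans hk).le⟩

end Markov

/-! ### First-step decomposition -/

section Path

variable {G : Type u}

/-- Prepending a term to a sequence. -/
def cons (y : G) (x : ℕ → G) : ℕ → G
  | 0 => y
  | n + 1 => x n

theorem setOf_cons_box (y : G) (n : ℕ) (t : ℕ → Set G) (x : ℕ → G) :
    (∀ i < n + 1, cons y x i ∈ t i) ↔ y ∈ t 0 ∧ ∀ i < n, x i ∈ t (i + 1) := by
  constructor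
  · exact fun h => ⟨h 0 n.succ_pos, fun i hi => h (i + 1) (Nat.succ_lt_succ hi)⟩
  · rintro ⟨h0, h1⟩ (_ | i) hi
    exacts [h0, h1 i (Nat.lt_of_succ_lt_succ hi)]

theorem walk_cons_succ [Group G] (y : G) (x : ℕ → G) (n : ℕ) : walk (cons y x) (n + 1) = y * walk x n := by
  induction n with
  | zero => rfl
  | succ n ih =>
    change walk (cons y x) (n + 1) * x (n + 1) = y * (walk x n * x (n + 1))
    rw [ih, mul_assoc]

theorem smul_walk_cons_mem_iff [Group G] {A A' : Set (ℕ → G)}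
    (h : A = (fun (ω : ℕ → G) n => ω (n + 1)) ⁻¹' A') (g y : G) (x : ℕ → G) :
    g • walk (cons y x) ∈ A ↔ (g * y) • walk x ∈ A' := by
  rw [h, Set.mem_preimage]
  congr! 1
  funext n
  change g * walk (cons y x) (n + 1) = g * y * walk x n
  rw [walk_cons_succ, mul_assoc]

variable [MeasurableSpace G]

/-! ### Tail sets -/

/-- A set of paths that, for each `n`, only depends measurably on the path from time `n` on. -/
def IsTailSet (A : Set (ℕ → G)) : Prop :=
  ∃ T : ℕ → Set (ℕ → G), T 0 = A ∧ (∀ m, MeasurableSet (T m)) ∧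
    ∀ m, T m = (fun (ω : ℕ → G) n => ω (n + 1)) ⁻¹' T (m + 1)

theorem isTailSet_of_measurableSet_shiftInvariantAlgebra {A : Set (ℕ → G)}
    (hA : MeasurableSet[shiftInvariantAlgebra G] A) : IsTailSet A :=
  ⟨fun _ => A, rfl, fun _ => hA.1, fun _ => hA.2.symm⟩

theorem isTailSet_of_measurableSet_tailAlgebra {A : Set (ℕ → G)}
    (hA : MeasurableSet[tailAlgebra G] A) : IsTailSet A := by
  have h : ∀ m : ℕ, ∃ T : Set (ℕ → G), MeasurableSet T ∧
      (fun (ω : ℕ → G) n => ω (n + m)) ⁻¹' T = A := by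
    intro m
    have hle : tailAlgebra G ≤
        MeasurableSpace.comap (fun (ω : ℕ → G) n => ω (n + m)) MeasurableSpace.pi := by
      refine (iInf_le _ m).trans (iSup_le fun k => iSup_le fun hk => ?_)
      rintro _ ⟨s, hs, rfl⟩
      refine ⟨(fun ω : ℕ → G => ω (k - m)) ⁻¹' s, measurable_pi_apply (k - m) hs, ?_⟩
      ext ω
      simp [Nat.sub_add_cancel hk]
    exact hle A hA
  choose T hT hTA using h
  refine ⟨T, by simpa using hTA 0, hT, fun m => ?_⟩
  -- The sets `T m` were chosen independently of each other. They are compatible because the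
  -- `m`-fold shift is surjective, so that `T m` is determined by its preimage `A`.
  have hsurj : Function.Surjective fun (ω : ℕ → G) n => ω (n + m) := fun ω =>
    ⟨fun n => ω (n - m), by ext n; simp⟩
  refine hsurj.preimage_injective ?_
  change _ ⁻¹' T m = _ ⁻¹' (_ ⁻¹' T (m + 1))
  rw [hTA m, ← hTA (m + 1), ← Set.preimage_comp]
  congr 1
  ext ω n
  simp [Nat.add_right_comm, ← Nat.add_assoc]

/-! ### Law of the increments and hitting probabilities -/

theorem ext_of_forall_box {μ μ' : Measure (ℕ → G)} [IsFiniteMeasure μ]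
    (H : ∀ (n : ℕ) (t : ℕ → Set G), (∀ i, MeasurableSet (t i)) →
      μ {x | ∀ i < n, x i ∈ t i} = μ' {x | ∀ i < n, x i ∈ t i}) : μ = μ' := by
  classical
  refine ext_of_generate_finite _ generateFrom_squareCylinders.symm
    (isPiSystem_squareCylinders (fun _ => MeasurableSpace.isPiSystem_measurableSet)
      fun _ => MeasurableSet.univ) ?_ ?_
  · rintro _ ⟨s, t, ht, rfl⟩
    have hbox : (s : Set ℕ).pi t =
        {x | ∀ i < s.sup id + 1, x i ∈ if i ∈ s then t i else Set.univ} := by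
      ext x
      constructor
      · intro h i _
        split_ifs with hi
        exacts [h i hi, Set.mem_univ _]
      · intro h i hi
        have := h i (Nat.lt_succ_of_le (Finset.le_sup (f := id) hi))
        rwa [if_pos (by simpa using hi)] at this
    rw [hbox]
    refine H _ _ fun i => ?_
    split_ifs
    exacts [ht i trivial, MeasurableSet.univ]
  · simpa using H 0 (fun _ => Set.univ) fun _ => MeasurableSet.univ

theorem measurable_cons : Measurable fun p : G × (ℕ → G) => cons p.1 p.2 := by
  refine measurable_pi_lambda _ fun n => ?_
  cases n with
  | zero => exact measurable_fst
  | succ n => exact (measurable_pi_apply n).comp measurable_snd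

/-- Prepending an independent variable of law `μ` to an i.i.d. sequence again gives an i.i.d.
sequence; this is what allows conditioning on the first step. -/
theorem map_cons_prod_infinitePi (μ : Measure G) [IsProbabilityMeasure μ] :
    (μ.prod (Measure.infinitePi fun _ : ℕ => μ)).map (fun p => cons p.1 p.2) =
      Measure.infinitePi fun _ : ℕ => μ := by
  have := Measure.isProbabilityMeasure_map (μ := μ.prod (Measure.infinitePi fun _ : ℕ => μ))
    (measurable_cons (G := G)).aemeasurable
  have hbox : ∀ (n : ℕ) (t : ℕ → Set G), {x : ℕ → G | ∀ i < n, x i ∈ t i} =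
      Set.pi (Finset.range n : Set ℕ) t := fun n t => by
    ext x
    simp [Set.mem_pi]
  refine ext_of_forall_box fun n t ht => ?_
  have hmeas : ∀ (n : ℕ) (t : ℕ → Set G), (∀ i, MeasurableSet (t i)) →
      MeasurableSet {x : ℕ → G | ∀ i < n, x i ∈ t i} := fun n t ht => by
    rw [hbox]
    exact MeasurableSet.pi (Finset.countable_toSet _) fun i _ => ht i
  rw [Measure.map_apply measurable_cons (hmeas n t ht)]
  cases n with
  | zero => simp
  | succ n =>
    have h : (fun p : G × (ℕ → G) => cons p.1 p.2) ⁻¹' {x | ∀ i < n + 1, x i ∈ t i} =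
        t 0 ×ˢ {x | ∀ i < n, x i ∈ t (i + 1)} := by
      ext p
      exact setOf_cons_box p.1 n t p.2
    rw [h, Measure.prod_prod, hbox, hbox, Measure.infinitePi_pi _ fun i _ => ht i,
      Measure.infinitePi_pi _ fun i _ => ht (i + 1), Finset.prod_range_succ', mul_comm]

/-- The law of the sequence of increments. -/
noncomputable abbrev incrementMeasure (ν : ProbSpace G) : Measure (ℕ → G) :=
  Measure.infinitePi fun _ : ℕ => toMeasure ν

/-- The probability that the walk started at `g` is in `A`. -/
noncomputable def hitProb [Group G] (ν : ProbSpace G) (A : Set (ℕ → G)) (g : G) : ℝ :=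
  (incrementMeasure ν).real {x | g • walk x ∈ A}

theorem abs_hitProb_le_one [Group G] (ν : ProbSpace G) (A : Set (ℕ → G)) (g : G) : |hitProb ν A g| ≤ 1 := by
  rw [hitProb, abs_of_nonneg measureReal_nonneg]
  exact measureReal_le_one

variable [DiscreteMeasurableSpace G]

theorem lintegral_toMeasure (ν : ProbSpace G) (f : G → ℝ≥0∞) :
    ∫⁻ y, f y ∂(toMeasure ν) = ∑' y, ENNReal.ofReal (ν.1 y) * f y := by
  rw [toMeasure, lintegral_sum_measure]
  refine tsum_congr fun y => ?_
  rw [lintegral_smul_measure, lintegral_dirac' _ Measurable.of_discrete, smul_eq_mul]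

theorem incrementMeasure_apply_eq_tsum (ν : ProbSpace G) {E : Set (ℕ → G)} (hE : MeasurableSet E) :
    incrementMeasure ν E =
      ∑' y, ENNReal.ofReal (ν.1 y) * incrementMeasure ν {x | cons y x ∈ E} := by
  conv_lhs => rw [incrementMeasure, ← map_cons_prod_infinitePi (toMeasure ν)]
  rw [Measure.map_apply measurable_cons hE, Measure.prod_apply (measurable_cons hE),
    lintegral_toMeasure]
  rfl

variable [Group G] [Countable G]

theorem measurableSet_setOf_smul_walk (g : G) {A : Set (ℕ → G)} (hA : MeasurableSet A) :
    MeasurableSet {x : ℕ → G | g • walk x ∈ A} :=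
  measurable_walk (measurable_smul_path g hA)

theorem hitProb_eq_markov (ν : ProbSpace G) {A A' : Set (ℕ → G)} (hA : MeasurableSet A)
    (h : A = (fun (ω : ℕ → G) n => ω (n + 1)) ⁻¹' A') : hitProb ν A = markov ν (hitProb ν A') := by
  funext g
  rw [hitProb, measureReal_def,
    incrementMeasure_apply_eq_tsum ν (measurableSet_setOf_smul_walk g hA),
    ENNReal.tsum_toReal_eq fun y => ENNReal.mul_ne_top ENNReal.ofReal_ne_top (measure_ne_top _ _)]
  refine tsum_congr fun y => ?_
  rw [ENNReal.toReal_mul, ENNReal.toReal_ofReal (ν.2.1 y), hitProb, measureReal_def]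
  congr! 3
  ext x
  exact smul_walk_cons_mem_iff h g y x

/-- For every `n`, the function is an `n`-th Markov iterate of another hitting probability, which is
bounded by one. Almost invariance with arbitrarily small error therefore applies, with `n` depending
on the error. -/
theorem hitProb_eq_of_isAlmostInvariant (ν : ProbSpace G) {T : ℕ → Set (ℕ → G)}
    (hT : ∀ m, MeasurableSet (T m))
    (hshift : ∀ m, T m = (fun (ω : ℕ → G) n => ω (n + 1)) ⁻¹' T (m + 1)) {k : G}
    (hk : ∀ ε > 0, ∃ n, IsAlmostInvariant ν n k ε) (m : ℕ) (g : G) :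
    hitProb ν (T m) (g * k) = hitProb ν (T m) g := by
  have hiter : ∀ n, hitProb ν (T m) = (markov ν)^[n] (hitProb ν (T (m + n))) := by
    intro n
    induction n with
    | zero => rfl
    | succ n ih =>
      rw [Function.iterate_succ_apply, ← add_assoc,
        ← hitProb_eq_markov ν (hT (m + n)) (hshift (m + n))]
      exact ih
  refine eq_of_abs_sub_le_all fun ε hε => ?_
  obtain ⟨n, hn⟩ := hk ε hε
  rw [hiter n]
  exact hn _ (abs_hitProb_le_one ν _) g

/-- A normal subgroup that asymptotically preserves the laws of the walk acts trivially on tail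
sets. -/
theorem ae_smul_walk_mem_iff (ν : ProbSpace G) {N : Subgroup G} [N.Normal]
    (hN : ∀ h ∈ N, ∀ ε > 0, ∃ n, IsAlmostInvariant ν n h ε) {A : Set (ℕ → G)} (hA : IsTailSet A)
    {k : G} (hk : k ∈ N) : ∀ᵐ x ∂(incrementMeasure ν), k • walk x ∈ A ↔ walk x ∈ A := by
  obtain ⟨T, rfl, hT, hshift⟩ := hA
  have hbox : ∀ (n : ℕ) (t : ℕ → Set G), MeasurableSet {x : ℕ → G | ∀ i < n, x i ∈ t i} :=
    fun n t => by
      simp only [Set.ofPred_forall]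
      exact MeasurableSet.iInter fun i => MeasurableSet.iInter fun _ =>
        measurable_pi_apply i MeasurableSet.of_discrete
  -- Peeling off a first increment `y` replaces `g` by `g * y` and `T m` by `T (m + 1)`, so the
  -- induction needs all `g` and `m`. The factor `k` stays on the left throughout and is moved to
  -- the right only at `n = 0`, as `k * g = g * (g⁻¹ * k * g)`; this is where normality enters.
  have H : ∀ (n : ℕ) (t : ℕ → Set G) (m : ℕ) (g : G),
      incrementMeasure ν ({x | ∀ i < n, x i ∈ t i} ∩ {x | (k * g) • walk x ∈ T m}) =
        incrementMeasure ν ({x | ∀ i < n, x i ∈ t i} ∩ {x | g • walk x ∈ T m}) := by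
    intro n
    induction n with
    | zero =>
      intro t m g
      have h := hitProb_eq_of_isAlmostInvariant ν hT hshift
        (hN _ (by simpa using ‹N.Normal›.conj_mem k hk g⁻¹)) m g
      rw [show g * (g⁻¹ * k * g) = k * g by group] at h
      simpa [hitProb, measureReal_def, ENNReal.toReal_eq_toReal_iff'] using h
    | succ n ih =>
      intro t m g
      rw [incrementMeasure_apply_eq_tsum ν
          ((hbox _ _).inter (measurableSet_setOf_smul_walk _ (hT m))),
        incrementMeasure_apply_eq_tsum ν
          ((hbox _ _).inter (measurableSet_setOf_smul_walk _ (hT m)))]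
      refine tsum_congr fun y => ?_
      congr 1
      have hset : ∀ g' : G, {x | cons y x ∈ {x : ℕ → G | ∀ i < n + 1, x i ∈ t i} ∩
          {x | g' • walk x ∈ T m}} = {_x | y ∈ t 0} ∩
            ({x | ∀ i < n, x i ∈ t (i + 1)} ∩ {x | (g' * y) • walk x ∈ T (m + 1)}) := by
        intro g'
        ext x
        rw [← Set.inter_assoc]
        exact and_congr (setOf_cons_box y n t x) (smul_walk_cons_mem_iff (hshift m) g' y x)
      rw [hset, hset]
      by_cases hy : y ∈ t 0
      · simpa [hy, mul_assoc] using ih (fun i => t (i + 1)) (m + 1) (g * y)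
      · simp [hy]
  have hE : ∀ g, MeasurableSet {x : ℕ → G | g • walk x ∈ T 0} := fun g =>
    measurableSet_setOf_smul_walk g (hT 0)
  -- Two events that meet every cylinder in equal measure give equal restricted measures, and each
  -- event is then almost surely contained in the other.
  have hrestrict : (incrementMeasure ν).restrict {x | k • walk x ∈ T 0} =
      (incrementMeasure ν).restrict {x | (1 : G) • walk x ∈ T 0} := by
    refine ext_of_forall_box fun n t _ => ?_
    rw [Measure.restrict_apply (hbox n t), Measure.restrict_apply (hbox n t)]
    simpa using H n t 0 1
  have h1 : ∀ᵐ x ∂(incrementMeasure ν), k • walk x ∈ T 0 → (1 : G) • walk x ∈ T 0 := by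
    refine (ae_restrict_iff' (hE k)).1 ?_
    rw [hrestrict]
    exact ae_restrict_mem (hE 1)
  have h2 : ∀ᵐ x ∂(incrementMeasure ν), (1 : G) • walk x ∈ T 0 → k • walk x ∈ T 0 := by
    refine (ae_restrict_iff' (hE 1)).1 ?_
    rw [← hrestrict]
    exact ae_restrict_mem (hE k)
  filter_upwards [h1, h2] with x hx1 hx2
  rw [one_smul] at hx1 hx2
  exact ⟨hx1, hx2⟩

/-! ### The action on the boundary -/

theorem ae_smul_eq_of_isTailSet {ν : ProbSpace G} {B : Type v} [MeasurableSpace B]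
    [StandardBorelSpace B] [MulAction G B] [MeasurableConstSMul G B] {bnd : (ℕ → G) → B}
    (hbnd : ∀ D, MeasurableSet D → IsTailSet (bnd ⁻¹' D))
    (hequiv : ∀ g : G, ∀ᵐ ω ∂(pathMeasure ν), bnd (g • ω) = g • bnd ω) {N : Subgroup G} [N.Normal]
    (hN : ∀ h ∈ N, ∀ ε > 0, ∃ n, IsAlmostInvariant ν n h ε) {k : G} (hk : k ∈ N) :
    ∀ᵐ b ∂((pathMeasure ν).map bnd), k • b = b := by
  have hmeas : Measurable bnd := fun D hD => by
    obtain ⟨T, hT0, hT, -⟩ := hbnd D hD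
    exact hT0 ▸ hT 0
  have hD : ∀ D : Set B, MeasurableSet D →
      ∀ᵐ b ∂((pathMeasure ν).map bnd), (k • b ∈ D ↔ b ∈ D) := by
    intro D hD
    have hsmul : MeasurableSet {b : B | k • b ∈ D} := measurable_const_smul k hD
    refine (ae_map_iff hmeas.aemeasurable (hsmul.iff hD)).2 ?_
    have h1 : ∀ᵐ ω ∂(pathMeasure ν), k • ω ∈ bnd ⁻¹' D ↔ ω ∈ bnd ⁻¹' D := by
      refine (ae_map_iff measurable_walk.aemeasurable ?_).2
        (ae_smul_walk_mem_iff ν hN (hbnd D hD) hk)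
      exact (measurable_smul_path k (hmeas hD)).iff (hmeas hD)
    filter_upwards [h1, hequiv k] with ω hω1 hω2
    rwa [Set.mem_preimage, Set.mem_preimage, hω2] at hω1
  -- Countably many generating sets separate the points of `B`, so agreement of `k • b` and `b` on
  -- all of them forces equality off a single null set.
  have hall := ae_all_iff.2 fun n =>
    hD _ (MeasurableSpace.measurableSet_natGeneratingSequence (α := B) n)
  have := upgradeStandardBorel B
  filter_upwards [hall] with b hb
  refine MeasurableSpace.separating_of_generateFrom
    (Set.range (MeasurableSpace.natGeneratingSequence B)) (h := ?_) _ _ ?_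
  · rw [MeasurableSpace.generateFrom_natGeneratingSequence]
    infer_instance
  · rintro _ ⟨n, rfl⟩
    exact hb n

theorem ae_smul_eq_of_mem_amenableRadical {ν : ProbSpace G}
    (hν : ∀ N : Subgroup G, N.Normal → IsAmenable N → ∀ h ∈ N,
      ∀ ε > 0, ∃ n, IsAlmostInvariant ν n h ε) {B : Type v} [MeasurableSpace B]
    [StandardBorelSpace B] [MulAction G B] [MeasurableConstSMul G B] {bnd : (ℕ → G) → B}
    (hbnd : ∀ D, MeasurableSet D → IsTailSet (bnd ⁻¹' D))
    (hequiv : ∀ g : G, ∀ᵐ ω ∂(pathMeasure ν), bnd (g • ω) = g • bnd ω) {g : G} (hg : g ∈ amenableRadical G) :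
    ∀ᵐ b ∂((pathMeasure ν).map bnd), g • b = b := by
  -- As `K` is a subgroup, it suffices to treat each normal amenable subgroup; amenability of their
  -- supremum is not needed.
  let K : Subgroup G :=
    { carrier := {g | ∀ᵐ b ∂((pathMeasure ν).map bnd), g • b = b}
      one_mem' := show ∀ᵐ _ ∂_, _ from Eventually.of_forall fun b => one_smul G b
      mul_mem' := fun {g h} hg hh => by
        change ∀ᵐ b ∂_, (g * h) • b = b
        filter_upwards [hg, hh] with b hb1 hb2
        rw [mul_smul, hb2, hb1]
      inv_mem' := fun {g} hg => by
        change ∀ᵐ b ∂_, g⁻¹ • b = b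
        filter_upwards [hg] with b hb
        rw [inv_smul_eq_iff, hb] }
  have hle : amenableRadical G ≤ K := sSup_le fun N hN k hk => by
    have := hN.1
    exact ae_smul_eq_of_isTailSet hbnd hequiv (hν N hN.1 hN.2) hk
  exact hle hg

end Path

end RandomWalk

theorem mainTheorem6 (G : Type*) [Group G] [Countable G]
    [MeasurableSpace G] [DiscreteMeasurableSpace G] :
    ∀ᶠ ν in residual (ProbSpace G),
      IsNondegenerate ν ∧
      (∀ (B : Type*) [MeasurableSpace B] [StandardBorelSpace B] [MulAction G B]
          [MeasurableConstSMul G B] (bnd : (ℕ → G) → B), IsTailBoundary ν B bnd →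
        ∀ g ∈ amenableRadical G, ∀ᵐ b ∂((pathMeasure ν).map bnd), g • b = b) ∧
      (∀ (B : Type*) [MeasurableSpace B] [StandardBorelSpace B] [MulAction G B]
          [MeasurableConstSMul G B] (bnd : (ℕ → G) → B), IsPoissonBoundary ν B bnd →
        ∀ g ∈ amenableRadical G, ∀ᵐ b ∂((pathMeasure ν).map bnd), g • b = b) := by
  filter_upwards [eventually_residual_isNondegenerate, eventually_residual_isAlmostInvariant]
    with ν hν1 hν2
  refine ⟨hν1, ?_, ?_⟩
  · intro B _ _ _ _ bnd hbnd g hg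
    exact ae_smul_eq_of_mem_amenableRadical hν2
      (fun D hD => isTailSet_of_measurableSet_tailAlgebra (hbnd.measurable hD))
      hbnd.equivariant hg
  · intro B _ _ _ _ bnd hbnd g hg
    exact ae_smul_eq_of_mem_amenableRadical hν2
      (fun D hD => isTailSet_of_measurableSet_shiftInvariantAlgebra (hbnd.measurable hD))
      hbnd.equivariant hg
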